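/- Conventions. All graphs are finite and simple. A caterpillar is a tree such that removing all its leaves (degree-one vertices) leaves a path, called its spine; for $\Delta\ge 2$ it is $\Delta$-regular if its spine has at least one vertex and every spine vertex has degree $\Delta$ in the tree. A packing of $n$-vertex graphs $G_1,\dots,G_h$ is an $n$-vertex graph $G$ (the host graph) that contains copies of $G_1,\dots,G_h$ as pairwise edge-disjoint spanning subgraphs. A graph is $k$-planar if it has a drawing in the plane (vertices are distinct points, edges are simple arcs joining their end-vertices and passing through no other vertex) in which every edge is crossed at most $k$ times, where the crossings on an edge $e$ are the pairs of an edge $e'\neq e$ and a non-vertex point common to $e$ and $e'$; a packing is $k$-planar if its host graph is. Theorem. There is an absolute constant $c$ such that the following holds for all integers $h\ge 1$ and $n$. Let $C_1,\dots,C_h$ be $n$-vertex caterpillars such that $C_i$ is $\Delta_i$-regular for $1\le i\le h$, and $\Delta_h\le\Delta_{h-1}\le\dots\le\Delta_1\le n-h$. If $$\sum_{i=1}^h\Delta_i\le n-1\qquad\text{and}\qquad \sum_{i=2}^h\left\lceil\frac{\Delta_i}{2}\right\rceil<\frac{n-(\Delta_1-1)}{2},$$ then $C_1,\dots,C_h$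 admit a $k$-planar packing for some $k\le c\,\Delta_1h^2$. -/

import Mathlib

/-- The spine of a graph: what is left after removing all leaves (vertices of degree one). -/
def spine {V : Type*} (G : SimpleGraph V) [G.LocallyFinite] : Set V :=
  {v | G.degree v ≠ 1}

/-- A caterpillar: a tree such that removing all leaves leaves a path. -/
def IsCaterpillar {V : Type*} (G : SimpleGraph V) [G.LocallyFinite] : Prop :=
  G.IsTree ∧ ∃ σ : ℕ, Nonempty (G.induce (spine G) ≃g SimpleGraph.pathGraph σ)

/-- A `Δ`-regular caterpillar (`Δ ≥ 2`): a caterpillar with at least one spine vertex all of whose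
spine vertices have degree `Δ`. -/
def IsRegularCaterpillar {V : Type*} (G : SimpleGraph V) [G.LocallyFinite] (Δ : ℕ) : Prop :=
  IsCaterpillar G ∧ 2 ≤ Δ ∧ (spine G).Nonempty ∧ ∀ v ∈ spine G, G.degree v = Δ

/-- A drawing of a graph in the plane: distinct vertices are distinct points, every edge is a
simple arc joining the points of its two end-vertices, and no edge passes through the point of
a vertex that is not one of its ends. -/
structure Drawing {V : Type*} (G : SimpleGraph V) where
  /-- the point representing a vertex -/
  point : V → ℝ × ℝ
  point_injective : Function.Injective point
  /-- the curve representing an edge (with an arbitrary direction of travel) -/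
  curve : G.edgeSet → unitInterval → ℝ × ℝ
  curve_continuous : ∀ e, Continuous (curve e)
  curve_injective : ∀ e, Function.Injective (curve e)
  curve_ends : ∀ e : G.edgeSet, s(curve e 0, curve e 1) = Sym2.map point (e : Sym2 V)
  curve_avoids : ∀ (e : G.edgeSet) (t : unitInterval) (v : V),
    curve e t = point v → v ∈ (e : Sym2 V)

/-- The crossings on the edge `e`: pairs of another edge `e'` and a point, not the point of a
vertex, that lies on both. (If several edges meet `e` in one point, each of them counts.) -/
def Drawing.crossings {V : Type*} {G : SimpleGraph V} (D : Drawing G) (e : G.edgeSet) :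
    Set (G.edgeSet × (ℝ × ℝ)) :=
  {c | c.1 ≠ e ∧ c.2 ∈ Set.range (D.curve e) ∧ c.2 ∈ Set.range (D.curve c.1) ∧
    c.2 ∉ Set.range D.point}

/-- A `k`-planar graph: one with a drawing in which every edge is crossed at most `k` times. -/
def IsKPlanar {V : Type*} (k : ℕ) (G : SimpleGraph V) : Prop :=
  ∃ D : Drawing G, ∀ e : G.edgeSet, (D.crossings e).encard ≤ k

/-- `G` is a packing of the graphs `C i` (host graph `G`): `G` contains copies of all the `C i` as
pairwise edge-disjoint spanning subgraphs. -/
def IsPacking {ι W : Type*} {V : ι → Type*} (C : ∀ i, SimpleGraph (V i)) (G : SimpleGraph W) :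
    Prop :=
  ∃ η : ∀ i, V i ≃ W,
    (∀ i, (C i).map (η i).toEmbedding ≤ G) ∧
    ∀ i j, i ≠ j →
      Disjoint ((C i).map (η i).toEmbedding).edgeSet ((C j).map (η j).toEmbedding).edgeSet

/-!
Draw the host graph with its vertices `0, …, n - 1` in convex position and straight edges; an edge
is then the chord joining the residues of `a` and `a + ℓ` for some integer `a` and some length `ℓ`.
Drawn as a zigzag, a `Δ`-regular caterpillar has at most one edge of each length `ℓ`, and the sums
`a + (a + ℓ)` of all its edges lie in a window of `Δ` consecutive integers. Rotating the polygon by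
`r` shifts this window by `2 r`, and a chord determines its sum in `(0, n]`, so caterpillars whose
windows are disjoint parts of `(0, n]` are edge-disjoint. Windows starting at even integers fit into
`(0, L]` with `L = 2 ∑_{i ≥ 2} ⌈Δ_i / 2⌉ + Δ_1`, and the hypothesis says that `L ≤ n`. Two chords
with sums in `(0, L]` are so close to parallel that they cross only if their lengths differ by less
than `L`; hence each edge is crossed at most `2 h L ≤ 4 Δ_1 h²` times.
-/

section Drawing

/-- The point of the unit parabola with abscissa `x`; the vertices of the host graph are drawn at
such points because these are in convex position. -/
def parabolaPoint (x : ℝ) : ℝ × ℝ := (x, x ^ 2)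

/-- The straight segment between two points of the unit parabola, as a parametrized curve. -/
def parabolaChord (x y : ℝ) (t : unitInterval) : ℝ × ℝ :=
  AffineMap.lineMap (parabolaPoint x) (parabolaPoint y) (t : ℝ)

variable {x y x' y' : ℝ} {p q : ℝ × ℝ}

theorem parabolaPoint_injective : Function.Injective parabolaPoint := fun _ _ h =>
  congrArg Prod.fst h

theorem parabolaChord_injective (hxy : x ≠ y) : Function.Injective (parabolaChord x y) :=
  (AffineMap.lineMap_injective ℝ (parabolaPoint_injective.ne hxy)).comp Subtype.val_injective

theorem snd_eq_of_mem_range_parabolaChord (hp : p ∈ Set.range (parabolaChord x y)) :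
    p.2 = (x + y) * p.1 - x * y := by
  obtain ⟨t, rfl⟩ := hp
  simp only [parabolaChord, parabolaPoint, AffineMap.lineMap_apply_module', Prod.snd_add,
    Prod.smul_snd, Prod.snd_sub, Prod.fst_add, Prod.smul_fst, Prod.fst_sub, smul_eq_mul]
  ring

theorem fst_mem_Icc_of_mem_range_parabolaChord (hxy : x ≤ y)
    (hp : p ∈ Set.range (parabolaChord x y)) : p.1 ∈ Set.Icc x y := by
  obtain ⟨t, rfl⟩ := hp
  rw [parabolaChord, AffineMap.fst_lineMap, ← segment_eq_Icc hxy, segment_eq_image_lineMap]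
  exact Set.mem_image_of_mem _ t.2

theorem eq_or_eq_of_parabolaPoint_mem_range {z : ℝ}
    (hz : parabolaPoint z ∈ Set.range (parabolaChord x y)) : z = x ∨ z = y := by
  have hline : z ^ 2 = (x + y) * z - x * y := snd_eq_of_mem_range_parabolaChord hz
  have hroots : (z - x) * (z - y) = 0 := by linear_combination hline
  simpa only [mul_eq_zero, sub_eq_zero] using hroots

theorem fst_mem_Ioo_of_mem_range_parabolaChord (hxy : x ≤ y)
    (hp : p ∈ Set.range (parabolaChord x y)) (hp' : p ∉ Set.range parabolaPoint) :
    p.1 ∈ Set.Ioo x y := by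
  obtain ⟨hx, hy⟩ := fst_mem_Icc_of_mem_range_parabolaChord hxy hp
  have hline := snd_eq_of_mem_range_parabolaChord hp
  have hne (z : ℝ) (hz : (z - x) * (z - y) = 0) : p.1 ≠ z := by
    rintro rfl
    exact hp' ⟨p.1, Prod.ext rfl (by simp only [parabolaPoint]; linear_combination hz - hline)⟩
  exact ⟨lt_of_le_of_ne hx (hne x (by ring)).symm, lt_of_le_of_ne hy (hne y (by ring))⟩

theorem eq_of_mem_range_parabolaChord (hne : s(x, y) ≠ s(x', y'))
    (hp : p ∈ Set.range (parabolaChord x y)) (hp' : p ∈ Set.range (parabolaChord x' y'))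
    (hq : q ∈ Set.range (parabolaChord x y)) (hq' : q ∈ Set.range (parabolaChord x' y')) :
    p = q := by
  have hpl := snd_eq_of_mem_range_parabolaChord hp
  have hpl' := snd_eq_of_mem_range_parabolaChord hp'
  have hql := snd_eq_of_mem_range_parabolaChord hq
  have hql' := snd_eq_of_mem_range_parabolaChord hq'
  by_cases hslope : x + y = x' + y'
  · have hroots : (x - x') * (x - y') = 0 := by
      linear_combination x * hslope - hslope * p.1 - hpl + hpl'
    refine absurd (Sym2.eq_iff.2 ?_) hne
    rcases mul_eq_zero.1 hroots with h | h
    · exact Or.inl ⟨by linarith, by linarith⟩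
    · exact Or.inr ⟨by linarith, by linarith⟩
  · have hfst : p.1 = q.1 := mul_left_cancel₀ (sub_ne_zero.2 hslope) (by
      linear_combination hpl' - hpl - (hql' - hql))
    exact Prod.ext hfst (by rw [hpl, hql, hfst])

theorem interlace_of_mem_range_parabolaChord (hxy : x ≤ y) (hxy' : x' ≤ y')
    (hne : s(x, y) ≠ s(x', y')) (hp : p ∈ Set.range (parabolaChord x y))
    (hp' : p ∈ Set.range (parabolaChord x' y')) (hpoint : p ∉ Set.range parabolaPoint) :
    (x < x' ∧ x' < y ∧ y < y') ∨ (x' < x ∧ x < y' ∧ y' < y) := by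
  obtain ⟨hx, hy⟩ := fst_mem_Ioo_of_mem_range_parabolaChord hxy hp hpoint
  obtain ⟨hx', hy'⟩ := fst_mem_Ioo_of_mem_range_parabolaChord hxy' hp' hpoint
  -- Both products are the height of `p` above the parabola, so the two intervals around the
  -- abscissa of `p` cannot be nested.
  have hheight : (p.1 - x) * (y - p.1) = (p.1 - x') * (y' - p.1) := by
    linear_combination snd_eq_of_mem_range_parabolaChord hp' -
      snd_eq_of_mem_range_parabolaChord hp
  rcases lt_trichotomy x x' with hlt | rfl | hlt
  · refine Or.inl ⟨hlt, hx'.trans hy, ?_⟩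
    by_contra! hle
    exact hheight.not_gt (mul_lt_mul (by linarith) (by linarith) (by linarith) (by linarith))
  · have := mul_left_cancel₀ (sub_pos.2 hx).ne' hheight
    exact absurd (by rw [sub_left_inj.1 this]) hne
  · refine Or.inr ⟨hlt, hx.trans hy', ?_⟩
    by_contra! hle
    exact hheight.not_lt (mul_lt_mul (by linarith) (by linarith) (by linarith) (by linarith))

end Drawing

section ConvexDrawing

variable {V : Type*} [LinearOrder V]

/-- Two chords of a convex polygon whose vertices are labelled by a linear order, in the order of
the boundary, cross. -/
def ChordsCross (e e' : Sym2 V) : Prop :=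
  (e.inf < e'.inf ∧ e'.inf < e.sup ∧ e.sup < e'.sup) ∨
    (e'.inf < e.inf ∧ e.inf < e'.sup ∧ e'.sup < e.sup)

theorem ChordsCross.symm {e e' : Sym2 V} (h : ChordsCross e e') : ChordsCross e' e := Or.symm h

theorem mk_inf_sup (e : Sym2 V) : s(e.inf, e.sup) = e := Sym2.sortEquiv.symm_apply_apply e

theorem inf_lt_sup_of_mem_edgeSet {G : SimpleGraph V} {e : Sym2 V} (he : e ∈ G.edgeSet) :
    e.inf < e.sup := by
  induction e with
  | _ u v => exact inf_lt_sup.2 (G.ne_of_adj he)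

/-- The straight-line drawing of a graph whose vertices are put on the unit parabola, with
abscissas given by `x`. -/
noncomputable def convexDrawing (G : SimpleGraph V) {x : V → ℝ} (hx : StrictMono x) :
    Drawing G where
  point v := parabolaPoint (x v)
  point_injective := parabolaPoint_injective.comp hx.injective
  curve e := parabolaChord (x (e : Sym2 V).inf) (x (e : Sym2 V).sup)
  curve_continuous e := AffineMap.lineMap_continuous.comp continuous_subtype_val
  curve_injective e := parabolaChord_injective (hx (inf_lt_sup_of_mem_edgeSet e.2)).ne
  curve_ends e := by
    conv_rhs => rw [← mk_inf_sup (e : Sym2 V)]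
    simp [parabolaChord]
  curve_avoids e t v h := by
    rw [← mk_inf_sup (e : Sym2 V), Sym2.mem_iff]
    exact (eq_or_eq_of_parabolaPoint_mem_range ⟨t, h⟩).imp (hx.injective ·) (hx.injective ·)

theorem encard_crossings_convexDrawing_le (G : SimpleGraph V) {x : V → ℝ} (hx : StrictMono x)
    (e : G.edgeSet) :
    ((convexDrawing G hx).crossings e).encard ≤ {e' ∈ G.edgeSet | ChordsCross ↑e e'}.encard := by
  have hle (e : Sym2 V) : x e.inf ≤ x e.sup := hx.monotone e.inf_le_sup
  have hne {e' : G.edgeSet} (h : e' ≠ e) :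
      s(x (e : Sym2 V).inf, x (e : Sym2 V).sup) ≠ s(x (e' : Sym2 V).inf, x (e' : Sym2 V).sup) := by
    simp only [← Sym2.map_mk, mk_inf_sup]
    exact (Sym2.map.injective hx.injective).ne (Subtype.coe_ne_coe.2 h.symm)
  refine Set.encard_le_encard_of_injOn (f := fun c => (c.1 : Sym2 V)) ?_ ?_
  · rintro ⟨e', p⟩ ⟨he', hp, hp', hvertex⟩
    have hpoint : p ∉ Set.range parabolaPoint := by
      rintro ⟨z, rfl⟩
      rcases eq_or_eq_of_parabolaPoint_mem_range hp with rfl | rfl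
      exacts [hvertex ⟨_, rfl⟩, hvertex ⟨_, rfl⟩]
    have hcross := interlace_of_mem_range_parabolaChord (hle e) (hle e') (hne he') hp hp' hpoint
    simp only [hx.lt_iff_lt] at hcross
    exact ⟨e'.2, hcross⟩
  · rintro ⟨e', p⟩ ⟨he', hp, hp', -⟩ ⟨e'', q⟩ ⟨-, hq, hq', -⟩ h
    obtain rfl : e' = e'' := Subtype.ext h
    exact Prod.ext rfl (eq_of_mem_range_parabolaChord (hne he') hp hp' hq hq')

theorem isKPlanar_of_encard_chordsCross_le {G : SimpleGraph V} {x : V → ℝ} (hx : StrictMono x)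
    {k : ℕ} (h : ∀ e ∈ G.edgeSet, {e' ∈ G.edgeSet | ChordsCross e e'}.encard ≤ k) :
    IsKPlanar k G :=
  ⟨convexDrawing G hx, fun e => (encard_crossings_convexDrawing_le G hx e).trans (h e e.2)⟩

end ConvexDrawing

section Chain

/-- The sequence that runs through the first `m` terms of `β 0`, then through the first `m` terms
of `β 1`, and so on. -/
def chain {α : Type*} (m : ℕ) (β : ℕ → ℕ → α) (t : ℕ) : α := β (t / m) (t % m)

theorem chain_mul_add {α : Type*} {m : ℕ} {β : ℕ → ℕ → α} (hm : 0 < m)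
    (hβ : ∀ q, β q m = β (q + 1) 0) (q : ℕ) {j : ℕ} (hj : j ≤ m) :
    chain m β (q * m + j) = β q j := by
  rcases hj.lt_or_eq with hlt | rfl
  · rw [chain, mul_comm, Nat.mul_add_div hm, Nat.mul_add_mod, Nat.div_eq_of_lt hlt,
      Nat.mod_eq_of_lt hlt, add_zero]
  · rw [← Nat.succ_mul, chain, Nat.mul_div_cancel _ hm, Nat.mul_mod_left, hβ]

end Chain

section Caterpillar

variable {V : Type*} {G : SimpleGraph V}

theorem exists_enumeration_of_card_eq_succ {s : Finset V} {m : ℕ} (hs : s.card = m + 1) {a b : V}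
    (ha : a ∈ s) (hb : b ∈ s) (hab : a ≠ b) :
    ∃ f : ℕ → V, f 0 = a ∧ f m = b ∧ ∀ v ∈ s, ∃ j ≤ m, f j = v := by
  classical
  have hm : m ≠ 0 := by
    rintro rfl
    exact hab (Finset.card_le_one.1 hs.le a ha b hb)
  let ends : Fin (m + 1) → V := fun i => if i = 0 then a else b
  have hends : Finset.image ends {0, Fin.last m} ⊆ s := by
    simp only [Finset.image_subset_iff, ends]
    intro i _
    split_ifs
    exacts [ha, hb]
  have hinj : Set.InjOn ends ({0, Fin.last m} : Finset (Fin (m + 1))) := by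
    simp [ends, Set.InjOn, hm, hab, hab.symm]
  obtain ⟨g, hg⟩ := Finset.exists_equiv_extend_of_card_eq (by simp [hs]) hends hinj
  refine ⟨fun j => g (Fin.ofNat (m + 1) j), ?_, ?_, fun v hv => ⟨(g.symm ⟨v, hv⟩).val, ?_⟩⟩
  · simpa [ends] using hg 0 (by simp)
  · simpa [ends, hm, Fin.natCast_eq_last] using hg (Fin.last m) (by simp)
  · simp [Nat.lt_succ_iff.1 (g.symm ⟨v, hv⟩).2]

section LocallyFinite

variable [G.LocallyFinite]

theorem exists_adj_ne_of_one_lt_degree {v : V} (hv : 1 < G.degree v) (u : V) :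
    ∃ w, G.Adj v w ∧ w ≠ u := by
  obtain ⟨w, hw, hwu⟩ := (G.neighborFinset v).exists_mem_ne hv u
  exact ⟨w, (G.mem_neighborFinset v w).1 hw, hwu⟩

theorem IsRegularCaterpillar.two_le {Δ : ℕ} (hG : IsRegularCaterpillar G Δ) : 2 ≤ Δ := hG.2.1

theorem mem_spine_or_mem_spine_of_adj (hG : G.Connected) (hs : (spine G).Nonempty) {v w : V}
    (h : G.Adj v w) : v ∈ spine G ∨ w ∈ spine G := by
  by_contra! hleaf
  obtain ⟨s, hs⟩ := hs
  have hs' : s ∉ ({v, w} : Set V) := by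
    rintro (rfl | rfl)
    exacts [hleaf.1 hs, hleaf.2 hs]
  obtain ⟨p⟩ := hG.preconnected v s
  obtain ⟨d, -, hfst, hsnd⟩ := p.exists_boundary_dart {v, w} (Set.mem_insert v _) hs'
  have hunique {x y : V} (hx : x ∉ spine G) (hy : G.Adj x y) (hd : d.fst = x) : d.snd = y :=
    (G.degree_eq_one_iff_existsUnique_adj.1 (not_not.1 hx)).unique (hd ▸ d.adj) hy
  rcases hfst with hd | hd
  · exact hsnd (Or.inr (hunique hleaf.1 h hd))
  · exact hsnd (Or.inl (hunique hleaf.2 h.symm hd))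

end LocallyFinite

theorem card_eq_of_degree_spine_eq [Fintype V] [DecidableRel G.Adj] {m : ℕ} (hG : G.IsTree)
    (hdeg : ∀ v ∈ spine G, G.degree v = m + 1) :
    Fintype.card V = Nat.card (spine G) * m + 2 := by
  classical
  have hdegree (v : V) : G.degree v = 1 + if v ∈ spine G then m else 0 := by
    split_ifs with hv
    · rw [hdeg v hv, add_comm]
    · exact not_not.1 hv
  have hsum : ∑ v, G.degree v = Fintype.card V + Nat.card (spine G) * m := by
    simp only [hdegree, Finset.sum_add_distrib, ← Finset.sum_filter, Finset.sum_const,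
      Nat.card_eq_fintype_card, Fintype.card_subtype]
    simp
  have hedges := hG.card_edgeFinset
  have hhandshake := G.sum_degrees_eq_twice_card_edges
  omega

/-- The sequence `P 0, …, P (σ + 1)` is a path of `G` (repetitions are excluded only at distance
two) whose inner vertices form a vertex cover. In a caterpillar it is the spine, extended by a leaf
at both ends. -/
structure IsCoveringPath (G : SimpleGraph V) (σ : ℕ) (P : ℕ → V) : Prop where
  adj : ∀ q ≤ σ, G.Adj (P q) (P (q + 1))
  ne : ∀ q < σ, P q ≠ P (q + 2)
  cover : ∀ u v, G.Adj u v → ∃ q < σ, u = P (q + 1) ∨ v = P (q + 1)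

theorem IsCaterpillar.exists_spine_sequence [G.LocallyFinite] (hG : IsCaterpillar G)
    (hs : (spine G).Nonempty) :
    ∃ (σ : ℕ) (p : ℕ → V), Nat.card (spine G) = σ ∧ 0 < σ ∧ spine G = p '' Set.Iio σ ∧
      Set.InjOn p (Set.Iio σ) ∧ ∀ i, i + 1 < σ → G.Adj (p i) (p (i + 1)) := by
  obtain ⟨-, σ, ⟨φ⟩⟩ := hG
  obtain ⟨s, hs⟩ := hs
  have hp {i : ℕ} (hi : i < σ) :
      (if h : i < σ then (φ.symm ⟨i, h⟩ : V) else s) = φ.symm ⟨i, hi⟩ := dif_pos hi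
  refine ⟨σ, fun i => if h : i < σ then φ.symm ⟨i, h⟩ else s, ?_, ?_, ?_, ?_, ?_⟩
  · rw [Nat.card_congr φ.toEquiv, Nat.card_fin]
  · exact Fin.pos (φ ⟨s, hs⟩)
  · ext v
    constructor
    · exact fun hv => ⟨φ ⟨v, hv⟩, (φ ⟨v, hv⟩).2, by simp⟩
    · rintro ⟨i, hi, rfl⟩
      simpa only [hp hi] using (φ.symm ⟨i, hi⟩).2
  · intro i hi j hj h
    simp only [hp hi, hp hj] at h
    exact Fin.mk.inj_iff.1 (φ.symm.injective (Subtype.ext h))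
  · intro i hi
    simp only [hp hi, hp (Nat.lt_of_succ_lt hi)]
    exact φ.symm.map_adj_iff.2 (SimpleGraph.pathGraph_adj.2 (Or.inl rfl))

theorem exists_extension_of_path [G.LocallyFinite] {σ : ℕ} {p : ℕ → V} (hσ : 0 < σ)
    (hinj : Set.InjOn p (Set.Iio σ)) (hadj : ∀ i, i + 1 < σ → G.Adj (p i) (p (i + 1)))
    (hdeg : ∀ i < σ, 1 < G.degree (p i)) :
    ∃ P : ℕ → V, (∀ i < σ, P (i + 1) = p i) ∧ (∀ q ≤ σ, G.Adj (P q) (P (q + 1))) ∧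
      ∀ q < σ, P q ≠ P (q + 2) := by
  obtain ⟨a, ha, hane⟩ := exists_adj_ne_of_one_lt_degree (hdeg 0 hσ) (p 1)
  let P : ℕ → V
    | 0 => a
    | i + 1 => p i
  obtain ⟨b, hb, hbne⟩ :=
    exists_adj_ne_of_one_lt_degree (hdeg (σ - 1) (Nat.sub_lt hσ one_pos)) (P (σ - 1))
  have hP {i : ℕ} (hi : i ≤ σ) : Function.update P (σ + 1) b i = P i :=
    Function.update_of_ne (by omega) _ _
  have hlast : Function.update P (σ + 1) b (σ + 1) = b := Function.update_self ..
  have hσP : P σ = p (σ - 1) := by rw [← Nat.succ_pred_eq_of_pos hσ]; rfl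
  refine ⟨Function.update P (σ + 1) b, fun i hi => hP hi, fun q hq => ?_, fun q hq => ?_⟩
  · rcases hq.lt_or_eq with hq | rfl
    · rw [hP hq.le, hP hq]
      cases q with
      | zero => exact ha.symm
      | succ q => exact hadj q hq
    · rw [hP le_rfl, hlast, hσP]
      exact hb
  · rcases (Nat.succ_le_of_lt hq).lt_or_eq with hq' | rfl
    · rw [hP hq.le, hP hq']
      cases q with
      | zero => exact hane
      | succ q => exact hinj.ne (Nat.lt_of_succ_lt hq) hq' (by omega)
    · rw [hP hq.le, hlast]
      exact hbne.symm

variable [Fintype V] [DecidableRel G.Adj] {m : ℕ}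

theorem IsRegularCaterpillar.exists_isCoveringPath (hG : IsRegularCaterpillar G (m + 1)) :
    ∃ (σ : ℕ) (P : ℕ → V), IsCoveringPath G σ P ∧ Fintype.card V = σ * m + 2 ∧
      ∀ q < σ, G.degree (P (q + 1)) = m + 1 := by
  obtain ⟨hcat, hm, hs, hdeg⟩ := hG
  obtain ⟨σ, p, hcard, hσ, hspine, hinj, hadj⟩ := hcat.exists_spine_sequence hs
  have hpdeg (i : ℕ) (hi : i < σ) : G.degree (p i) = m + 1 :=
    hdeg _ (hspine ▸ Set.mem_image_of_mem p hi)
  obtain ⟨P, hPp, hPadj, hPne⟩ := exists_extension_of_path hσ hinj hadj fun i hi => by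
    rw [hpdeg i hi]; omega
  refine ⟨σ, P, ⟨hPadj, hPne, fun u v huv => ?_⟩, ?_, fun q hq => by rw [hPp q hq, hpdeg q hq]⟩
  · have hcover {w : V} (hw : w ∈ spine G) : ∃ q < σ, w = P (q + 1) := by
      rw [hspine] at hw
      obtain ⟨q, hq, rfl⟩ := hw
      exact ⟨q, hq, (hPp q hq).symm⟩
    rcases mem_spine_or_mem_spine_of_adj hcat.1.connected hs huv with hu | hv
    · exact (hcover hu).imp fun q hq => ⟨hq.1, Or.inl hq.2⟩
    · exact (hcover hv).imp fun q hq => ⟨hq.1, Or.inr hq.2⟩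
  · rw [card_eq_of_degree_spine_eq hcat.1 hdeg, hcard]

theorem IsRegularCaterpillar.exists_neighbor_array (hG : IsRegularCaterpillar G (m + 1)) :
    ∃ (σ : ℕ) (N : ℕ → ℕ → V), Fintype.card V = σ * m + 2 ∧ (∀ q, N q m = N (q + 2) 0) ∧
      ∀ u v, G.Adj u v → ∃ q < σ, ∃ j ≤ m, s(u, v) = s(N (q + 1) 0, N q j) := by
  obtain ⟨σ, P, hP, hcard, hdeg⟩ := hG.exists_isCoveringPath
  have hm : m ≠ 0 := by have := hG.two_le; omega
  have henum (q : ℕ) : ∃ f : ℕ → V, f 0 = P q ∧ f m = P (q + 2) ∧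
      (q < σ → ∀ v, G.Adj (P (q + 1)) v → ∃ j ≤ m, f j = v) := by
    by_cases hq : q < σ
    · obtain ⟨f, hf⟩ := exists_enumeration_of_card_eq_succ
        ((G.card_neighborFinset_eq_degree _).trans (hdeg q hq))
        ((G.mem_neighborFinset _ _).2 (hP.adj q hq.le).symm)
        ((G.mem_neighborFinset _ _).2 (hP.adj (q + 1) hq)) (hP.ne q hq)
      simp only [SimpleGraph.mem_neighborFinset] at hf
      exact ⟨f, hf.1, hf.2.1, fun _ => hf.2.2⟩
    · exact ⟨fun j => if j = 0 then P q else P (q + 2), if_pos rfl, if_neg hm, fun h => absurd h hq⟩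
  choose N hfirst hlast hN using henum
  refine ⟨σ, N, hcard, fun q => by rw [hlast, hfirst], fun u v huv => ?_⟩
  obtain ⟨q, hq, rfl | rfl⟩ := hP.cover u v huv
  · obtain ⟨j, hj, rfl⟩ := hN q hq v huv
    exact ⟨q, hq, j, hj, by rw [hfirst]⟩
  · obtain ⟨j, hj, rfl⟩ := hN q hq u huv.symm
    exact ⟨q, hq, j, hj, by rw [hfirst, Sym2.eq_swap]⟩

/-- The left end of the edge of length `ℓ` in the zigzag labelling of a caterpillar of degree
`m + 1`. The edges from the `q`-th spine vertex to its neighbours have the lengths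
`q * m + 1, …, (q + 1) * m + 1`; their common end is the left one if `q` is even and the right one
if `q` is odd. -/
def zigzagLeft (m ℓ : ℕ) : ℤ := chain m (fun q j => -((q / 2 * m + q % 2 * j : ℕ) : ℤ)) (ℓ - 1)

theorem zigzagLeft_mul_add_add_one {m j : ℕ} (hm : 0 < m) (q : ℕ) (hj : j ≤ m) :
    zigzagLeft m (q * m + j + 1) = -((q / 2 * m + q % 2 * j : ℕ) : ℤ) := by
  refine chain_mul_add hm (fun q => ?_) q hj
  rcases Nat.even_or_odd' q with ⟨k, rfl | rfl⟩
  · rw [show (2 * k + 1) / 2 = k by omega, show 2 * k / 2 = k by omega]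
    simp
  · rw [show (2 * k + 1 + 1) / 2 = k + 1 by omega, show (2 * k + 1) / 2 = k by omega,
      show (2 * k + 1) % 2 = 1 by omega, one_mul, mul_zero, add_zero, Nat.succ_mul]

/-- The vertex at the integer `z` in the zigzag labelling. The neighbours `N q j` of the `q`-th
spine vertex are put in the order of `j`, to the right of the previous ones if `q` is even (starting
at `1`) and to their left if `q` is odd (starting at `0`). -/
def zigzagVertex {α : Type*} (m : ℕ) (N : ℕ → ℕ → α) (z : ℤ) : α :=
  if 0 < z then chain m (fun k => N (2 * k)) (z - 1).toNat
  else chain m (fun k => N (2 * k + 1)) (-z).toNat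

section Zigzag

variable {α : Type*} {N : ℕ → ℕ → α} {m j : ℕ} {z : ℤ}

theorem zigzagVertex_of_eq_one_add (hm : 0 < m) (hN : ∀ q, N q m = N (q + 2) 0) (k : ℕ)
    (hj : j ≤ m) (hz : z = 1 + (k * m + j : ℕ)) : zigzagVertex m N z = N (2 * k) j := by
  rw [hz, zigzagVertex, if_pos (by omega), add_sub_cancel_left, Int.toNat_natCast,
    chain_mul_add hm (fun _ => hN _) k hj]

theorem zigzagVertex_of_eq_neg (hm : 0 < m) (hN : ∀ q, N q m = N (q + 2) 0) (k : ℕ)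
    (hj : j ≤ m) (hz : z = -(k * m + j : ℕ)) : zigzagVertex m N z = N (2 * k + 1) j := by
  rw [hz, zigzagVertex, if_neg (by omega), neg_neg, Int.toNat_natCast,
    chain_mul_add hm (fun _ => hN _) k hj]

end Zigzag

theorem IsRegularCaterpillar.exists_zigzag {Δ : ℕ} (hG : IsRegularCaterpillar G Δ) :
    ∃ (w : ℤ) (f : ℤ → V) (a : ℕ → ℤ), ∀ e ∈ G.edgeSet, ∃ ℓ : ℕ, 0 < ℓ ∧ w ≤ a ℓ ∧
      a ℓ + ℓ < w + Fintype.card V ∧ 2 * a ℓ + ℓ ∈ Set.Ioc 0 (Δ : ℤ) ∧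
      e = s(f (a ℓ), f (a ℓ + ℓ)) := by
  obtain ⟨m, rfl⟩ : ∃ m, Δ = m + 1 := ⟨Δ - 1, by have := hG.two_le; omega⟩
  have hm : 0 < m := by have := hG.two_le; omega
  obtain ⟨σ, N, hcard, hN, hadj⟩ := hG.exists_neighbor_array
  have hσ : σ * m = σ / 2 * m + (σ + 1) / 2 * m := by rw [← add_mul]; congr 1; omega
  refine ⟨-(σ / 2 * m : ℕ), zigzagVertex m N, zigzagLeft m, fun e he => ?_⟩
  induction e with | _ u v
  obtain ⟨q, hq, j, hj, huv⟩ := hadj u v he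
  refine ⟨q * m + j + 1, by omega, ?_⟩
  rw [huv, zigzagLeft_mul_add_add_one hm q hj, hcard, hσ, Set.mem_Ioc]
  rcases Nat.even_or_odd' q with ⟨k, rfl | rfl⟩
  · have hleft : k * m ≤ σ / 2 * m := Nat.mul_le_mul_right m (by omega)
    have hright : k * m + m ≤ (σ + 1) / 2 * m := by
      rw [← Nat.succ_mul]; exact Nat.mul_le_mul_right m (by omega)
    rw [show 2 * k / 2 = k by omega, Nat.mul_mod_right, zero_mul, mul_assoc 2 k m,
      zigzagVertex_of_eq_neg hm hN k (Nat.zero_le m) rfl,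
      zigzagVertex_of_eq_one_add hm hN k hj (by omega)]
    exact ⟨by omega, by omega, by omega, rfl⟩
  · have hleft : k * m + m ≤ σ / 2 * m := by
      rw [← Nat.succ_mul]; exact Nat.mul_le_mul_right m (by omega)
    have hright : k * m + m ≤ (σ + 1) / 2 * m := by
      rw [← Nat.succ_mul]; exact Nat.mul_le_mul_right m (by omega)
    rw [show (2 * k + 1) / 2 = k by omega, show (2 * k + 1) % 2 = 1 by omega, one_mul,
      Nat.succ_mul (2 * k) m, mul_assoc 2 k m, zigzagVertex_of_eq_neg hm hN k hj rfl,
      zigzagVertex_of_eq_one_add hm hN (k + 1) (Nat.zero_le m) (by rw [Nat.succ_mul k m]; omega)]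
    exact ⟨by omega, by omega, by omega, Sym2.eq_swap⟩

end Caterpillar

section ModularChords

open Fin.IntCast

/-- The chord of the convex `n`-gon with vertex set `Fin n` whose ends are the residues of `x` and
`y` modulo `n`. -/
def chord (n : ℕ) [NeZero n] (x y : ℤ) : Sym2 (Fin n) := s((x : Fin n), (y : Fin n))

variable {n : ℕ} [NeZero n] {a a' : ℤ} {ℓ ℓ' L : ℕ}

theorem coe_intCast_eq_emod (x : ℤ) : (((x : Fin n) : ℕ) : ℤ) = x % n := by
  rw [Fin.val_intCast, Int.toNat_of_nonneg (Int.emod_nonneg x (NeZero.ne _))]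

theorem coe_inf_sup_chord (hℓ : 0 < ℓ) (hℓn : ℓ < n) (ha : 2 * a + ℓ ∈ Set.Ioc 0 (n : ℤ)) :
    (((chord n a (a + ℓ)).inf : ℤ) = a ∧ ((chord n a (a + ℓ)).sup : ℤ) = a + ℓ) ∨
      (((chord n a (a + ℓ)).inf : ℤ) = a + ℓ ∧ ((chord n a (a + ℓ)).sup : ℤ) = a + n) := by
  obtain ⟨hpos, hle⟩ := ha
  have hinf : ((chord n a (a + ℓ)).inf : ℤ) = min (a % n) ((a + ℓ) % n) := by
    rw [chord, Sym2.inf_mk, Fin.coe_min, Nat.cast_min, coe_intCast_eq_emod, coe_intCast_eq_emod]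
  have hsup : ((chord n a (a + ℓ)).sup : ℤ) = max (a % n) ((a + ℓ) % n) := by
    rw [chord, Sym2.sup_mk, Fin.coe_max, Nat.cast_max, coe_intCast_eq_emod, coe_intCast_eq_emod]
  have hright : (a + ℓ) % n = a + ℓ := Int.emod_eq_of_lt (by omega) (by omega)
  rcases le_or_gt 0 a with hnonneg | hneg
  · have hleft : a % n = a := Int.emod_eq_of_lt hnonneg (by omega)
    omega
  · have hleft : a % n = a + n := by
      rw [← Int.add_emod_right, Int.emod_eq_of_lt (by omega) (by omega)]
    omega

theorem chord_injective (hℓ : 0 < ℓ) (hℓn : ℓ < n) (ha : 2 * a + ℓ ∈ Set.Ioc 0 (n : ℤ))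
    (hℓ' : 0 < ℓ') (hℓn' : ℓ' < n) (ha' : 2 * a' + ℓ' ∈ Set.Ioc 0 (n : ℤ))
    (h : chord n a (a + ℓ) = chord n a' (a' + ℓ')) : a = a' ∧ ℓ = ℓ' := by
  have hends := coe_inf_sup_chord hℓ hℓn ha
  have hends' := coe_inf_sup_chord hℓ' hℓn' ha'
  rw [h] at hends
  simp only [Set.mem_Ioc] at ha ha'
  omega

theorem length_lt_of_chordsCross_chord (hℓ : 0 < ℓ) (hℓn : ℓ < n)
    (ha : 2 * a + ℓ ∈ Set.Ioc 0 (L : ℤ)) (hℓ' : 0 < ℓ') (hℓn' : ℓ' < n)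
    (ha' : 2 * a' + ℓ' ∈ Set.Ioc 0 (L : ℤ)) (hL : L ≤ n)
    (h : ChordsCross (chord n a (a + ℓ)) (chord n a' (a' + ℓ'))) : ℓ' < ℓ + L := by
  have hends := coe_inf_sup_chord hℓ hℓn (Set.Ioc_subset_Ioc_right (Nat.cast_le.2 hL) ha)
  have hends' := coe_inf_sup_chord hℓ' hℓn' (Set.Ioc_subset_Ioc_right (Nat.cast_le.2 hL) ha')
  obtain ⟨hpos, hle⟩ := ha
  obtain ⟨hpos', hle'⟩ := ha'
  simp only [ChordsCross, Fin.lt_def] at h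
  omega

end ModularChords

section IsZigzag

variable {n : ℕ} [NeZero n] {I J : Set ℤ}

/-- A zigzag in the convex `n`-gon: a graph all of whose edges are chords `{a, a + ℓ}` modulo `n`,
with at most one edge for each length `ℓ` and with all the sums `a + (a + ℓ)` in `I`. The sum fixes
the direction of the chord, and the length its distance from the centre. -/
def IsZigzag (I : Set ℤ) (H : SimpleGraph (Fin n)) : Prop :=
  ∃ a : ℕ → ℤ, ∀ e ∈ H.edgeSet, ∃ ℓ : ℕ, 0 < ℓ ∧ ℓ < n ∧ 2 * a ℓ + ℓ ∈ I ∧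
    e = chord n (a ℓ) (a ℓ + ℓ)

theorem IsZigzag.mono {H : SimpleGraph (Fin n)} (hH : IsZigzag I H) (hIJ : I ⊆ J) :
    IsZigzag J H := by
  obtain ⟨a, ha⟩ := hH
  refine ⟨a, fun e he => ?_⟩
  obtain ⟨ℓ, hℓ, hℓn, hI, h⟩ := ha e he
  exact ⟨ℓ, hℓ, hℓn, hIJ hI, h⟩

theorem IsZigzag.disjoint_edgeSet {H H' : SimpleGraph (Fin n)} (hH : IsZigzag I H)
    (hH' : IsZigzag J H') (hI : I ⊆ Set.Ioc 0 (n : ℤ)) (hJ : J ⊆ Set.Ioc 0 (n : ℤ))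
    (hIJ : Disjoint I J) : Disjoint H.edgeSet H'.edgeSet := by
  obtain ⟨a, ha⟩ := hH
  obtain ⟨a', ha'⟩ := hH'
  refine Set.disjoint_left.2 fun e he he' => ?_
  obtain ⟨ℓ, hℓ, hℓn, hsum, rfl⟩ := ha e he
  obtain ⟨ℓ', hℓ', hℓn', hsum', heq⟩ := ha' _ he'
  obtain ⟨hleft, rfl⟩ := chord_injective hℓ hℓn (hI hsum) hℓ' hℓn' (hJ hsum') heq
  exact Set.disjoint_left.1 hIJ hsum (hleft ▸ hsum')

theorem isKPlanar_iSup_of_isZigzag {ι : Type*} [Fintype ι] {L : ℕ} (hL : L ≤ n)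
    {H : ι → SimpleGraph (Fin n)} (hH : ∀ i, IsZigzag (Set.Ioc 0 (L : ℤ)) (H i)) :
    IsKPlanar (2 * Fintype.card ι * L) (⨆ i, H i) := by
  classical
  choose a ha using hH
  have hedge {e : Sym2 (Fin n)} (he : e ∈ (⨆ i, H i).edgeSet) : ∃ (i : ι) (ℓ : ℕ), 0 < ℓ ∧ ℓ < n ∧
      2 * a i ℓ + ℓ ∈ Set.Ioc 0 (L : ℤ) ∧ e = chord n (a i ℓ) (a i ℓ + ℓ) := by
    obtain ⟨i, hi⟩ := Set.mem_iUnion.1 (SimpleGraph.edgeSet_iSup (f := H) ▸ he)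
    exact ⟨i, ha i e hi⟩
  refine isKPlanar_of_encard_chordsCross_le (x := fun v : Fin n => (v : ℝ))
    (fun u v huv => Nat.cast_lt.2 huv) fun e he => ?_
  obtain ⟨i, ℓ, hℓ, hℓn, hsum, rfl⟩ := hedge he
  let crossing : Finset (Sym2 (Fin n)) :=
    (Finset.univ ×ˢ Finset.Ico (ℓ - L) (ℓ + L)).image fun c : ι × ℕ =>
      chord n (a c.1 c.2) (a c.1 c.2 + c.2)
  have hsubset : {e' ∈ (⨆ i, H i).edgeSet | ChordsCross (chord n (a i ℓ) (a i ℓ + ℓ)) e'} ⊆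
      crossing := by
    rintro e' ⟨he', hcross⟩
    obtain ⟨i', ℓ', hℓ', hℓn', hsum', rfl⟩ := hedge he'
    have hlt : ℓ' < ℓ + L := length_lt_of_chordsCross_chord hℓ hℓn hsum hℓ' hℓn' hsum' hL hcross
    have hgt : ℓ < ℓ' + L :=
      length_lt_of_chordsCross_chord hℓ' hℓn' hsum' hℓ hℓn hsum hL hcross.symm
    exact Finset.mem_image_of_mem _ (Finset.mem_product.2
      ⟨Finset.mem_univ i', Finset.mem_Ico.2 ⟨by omega, hlt⟩⟩ : (i', ℓ') ∈ _)
  have hcard : crossing.card ≤ 2 * Fintype.card ι * L := by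
    refine Finset.card_image_le.trans ?_
    rw [Finset.card_product, Finset.card_univ, Nat.card_Ico, mul_comm 2, mul_assoc]
    exact Nat.mul_le_mul_left _ (by omega)
  calc _ ≤ (crossing : Set (Sym2 (Fin n))).encard := Set.encard_le_encard hsubset
    _ ≤ _ := by rw [Set.encard_coe_eq_coe_finsetCard]; exact_mod_cast hcard

end IsZigzag

section Placement

variable {V : Type*} [Fintype V] {G : SimpleGraph V} [DecidableRel G.Adj] {Δ : ℕ}

theorem IsRegularCaterpillar.exists_adj (hG : IsRegularCaterpillar G Δ) (v : V) :
    ∃ u, G.Adj v u := by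
  obtain ⟨-, hΔ, -, hdeg⟩ := hG
  refine (G.degree_pos_iff_exists_adj v).1 ?_
  by_cases hv : v ∈ spine G
  · rw [hdeg v hv]; omega
  · rw [not_not.1 hv]; exact one_pos

open Fin.IntCast in
theorem IsRegularCaterpillar.exists_isZigzag_map (hG : IsRegularCaterpillar G Δ) {n : ℕ} [NeZero n]
    (hcard : Fintype.card V = n) (r : ℤ) :
    ∃ η : V ≃ Fin n, IsZigzag (Set.Ioc (2 * r) (2 * r + Δ)) (G.map η.toEmbedding) := by
  obtain ⟨w, f, a, ha⟩ := hG.exists_zigzag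
  rw [hcard] at ha
  let F (y : Fin n) : V := f (w + ((y : ℕ) - r - w) % n)
  have hF {z : ℤ} (hwz : w ≤ z) (hzw : z < w + n) : F (z + r : ℤ) = f z := by
    have hz : (z + r - r - w) % n = z - w := by
      rw [add_sub_cancel_right, Int.emod_eq_of_lt (by omega) (by omega)]
    simp only [F]
    rw [coe_intCast_eq_emod, sub_sub, Int.emod_sub_emod, ← sub_sub, hz, add_sub_cancel]
  have hsurj : Function.Surjective F := by
    intro v
    obtain ⟨u, hu⟩ := hG.exists_adj v
    obtain ⟨ℓ, hℓ, hw, hwn, -, he⟩ := ha s(v, u) hu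
    rcases Sym2.mem_iff.1 (he ▸ Sym2.mem_mk_left v u) with rfl | rfl
    · exact ⟨_, hF hw (by omega)⟩
    · exact ⟨_, hF (by omega) hwn⟩
  let η : V ≃ Fin n := (Equiv.ofBijective F
    ((Fintype.bijective_iff_surjective_and_card F).2 ⟨hsurj, by simp [hcard]⟩)).symm
  have hη {z : ℤ} (hwz : w ≤ z) (hzw : z < w + n) : η (f z) = (z + r : ℤ) := by
    rw [← hF hwz hzw]; exact Equiv.ofBijective_symm_apply_apply F _ _
  refine ⟨η, fun ℓ => a ℓ + r, fun e he => ?_⟩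
  rw [SimpleGraph.edgeSet_map] at he
  obtain ⟨e, he, rfl⟩ := he
  obtain ⟨ℓ, hℓ, hw, hwn, ⟨hpos, hle⟩, rfl⟩ := ha e he
  refine ⟨ℓ, hℓ, by omega, by dsimp only; constructor <;> omega, ?_⟩
  simp only [chord, Function.Embedding.sym2Map_apply, Sym2.map_mk, Equiv.coe_toEmbedding,
    hη hw (by omega), hη (z := a ℓ + ℓ) (by omega) hwn, add_right_comm]

end Placement

section Bands

variable {ι : Type*}

theorem exists_offsets (δ : ι → ℕ) (s : Finset ι) {o : ι} (ho : o ∉ s) :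
    ∃ r : ι → ℕ, r o = ∑ i ∈ s, δ i ∧ (∀ i ∈ s, r i + δ i ≤ r o) ∧
      (s : Set ι).Pairwise fun i j => r i + δ i ≤ r j ∨ r j + δ j ≤ r i := by
  classical
  induction s using Finset.induction_on generalizing o with
  | empty => exact ⟨0, by simp⟩
  | insert b s hb ih =>
    obtain ⟨r, hrb, hle, hpair⟩ := ih hb
    have hr {i : ι} (hi : i ∈ insert b s) :
        Function.update r o (δ b + ∑ i ∈ s, δ i) i = r i :=
      Function.update_of_ne (ne_of_mem_of_not_mem hi ho) _ _
    refine ⟨Function.update r o (δ b + ∑ i ∈ s, δ i), ?_, fun i hi => ?_, fun i hi j hj hij => ?_⟩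
    · rw [Function.update_self, Finset.sum_insert hb]
    · rw [hr hi, Function.update_self]
      rcases Finset.mem_insert.1 hi with rfl | his
      · omega
      · have := hle i his
        omega
    · simp only [hr hi, hr hj]
      rcases Finset.mem_insert.1 hi with rfl | his <;> rcases Finset.mem_insert.1 hj with rfl | hjs
      exacts [absurd rfl hij, Or.inr (hle j hjs), Or.inl (hle i his), hpair his hjs hij]

theorem exists_disjoint_bands [Fintype ι] [DecidableEq ι] (Δ : ι → ℕ) (o : ι) :
    ∃ r : ι → ℕ,
      (∀ i, Set.Ioc (2 * r i : ℤ) (2 * r i + Δ i) ⊆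
        Set.Ioc 0 ((2 * ∑ i ∈ Finset.univ.erase o, Δ i ⌈/⌉ 2 + Δ o : ℕ) : ℤ)) ∧
      ∀ i j, i ≠ j →
        Disjoint (Set.Ioc (2 * r i : ℤ) (2 * r i + Δ i))
          (Set.Ioc (2 * r j : ℤ) (2 * r j + Δ j)) := by
  -- The band of `o` comes last, so that its width need not be rounded up to an even number.
  obtain ⟨r, hro, hle, hpair⟩ := exists_offsets (fun i => Δ i ⌈/⌉ 2) (Finset.univ.erase o)
    (Finset.notMem_erase o _)
  have hceil (i : ι) : Δ i ≤ 2 * (Δ i ⌈/⌉ 2) := (ceilDiv_le_iff_le_mul two_pos).1 le_rfl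
  have hlast {i : ι} (hi : i ≠ o) : r i + Δ i ⌈/⌉ 2 ≤ r o := hle i (by simp [hi])
  have hseparated {i j : ι} (hij : i ≠ j) :
      r i + Δ i ⌈/⌉ 2 ≤ r j ∨ r j + Δ j ⌈/⌉ 2 ≤ r i := by
    rcases eq_or_ne i o with rfl | hi
    · exact Or.inr (hlast hij.symm)
    rcases eq_or_ne j o with rfl | hj
    · exact Or.inl (hlast hij)
    exact hpair (by simp [hi]) (by simp [hj]) hij
  refine ⟨r, fun i => Set.Ioc_subset_Ioc (by omega) ?_, fun i j hij => ?_⟩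
  · have := hceil i
    rcases eq_or_ne i o with rfl | hi
    · omega
    · have := hlast hi
      omega
  · have := hceil i
    have := hceil j
    rcases hseparated hij with hle | hle
    · exact Set.Ioc_disjoint_Ioc_of_le (by omega)
    · exact (Set.Ioc_disjoint_Ioc_of_le (by omega)).symm

end Bands

theorem theorem3_general {ι : Type*} [Fintype ι] [DecidableEq ι] {n : ℕ} {V : ι → Type*}
    [∀ i, Fintype (V i)] (C : ∀ i, SimpleGraph (V i)) [∀ i, DecidableRel (C i).Adj] (Δ : ι → ℕ)
    (o : ι) (hcard : ∀ i, Fintype.card (V i) = n) (hC : ∀ i, IsRegularCaterpillar (C i) (Δ i))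
    (hsum : 2 * ∑ i ∈ Finset.univ.erase o, Δ i ⌈/⌉ 2 + Δ o ≤ n) :
    ∃ G : SimpleGraph (Fin n), IsPacking C G ∧
      IsKPlanar (2 * Fintype.card ι * (2 * ∑ i ∈ Finset.univ.erase o, Δ i ⌈/⌉ 2 + Δ o)) G := by
  have : NeZero n := ⟨by have := (hC o).two_le; omega⟩
  obtain ⟨r, hband, hdisjoint⟩ := exists_disjoint_bands Δ o
  choose η hη using fun i => (hC i).exists_isZigzag_map (hcard i) (r i)
  have hband' (i : ι) : Set.Ioc (2 * r i : ℤ) (2 * r i + Δ i) ⊆ Set.Ioc 0 (n : ℤ) :=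
    (hband i).trans (Set.Ioc_subset_Ioc_right (Nat.cast_le.2 hsum))
  refine ⟨⨆ i, (C i).map (η i).toEmbedding, ⟨η, le_iSup _, fun i j hij => ?_⟩, ?_⟩
  · exact (hη i).disjoint_edgeSet (hη j) (hband' i) (hband' j) (hdisjoint i j hij)
  · exact isKPlanar_iSup_of_isZigzag hsum fun i => (hη i).mono (hband i)

section Arithmetic

variable {ι : Type*} {Δ : ι → ℕ} {s : Finset ι} {D : ℕ}

theorem two_mul_sum_ceilDiv_add_le_of_sum_ceil_lt {n : ℕ}
    (h : (∑ i ∈ s, (⌈(Δ i : ℝ) / 2⌉ : ℝ)) < ((n : ℝ) - ((D : ℝ) - 1)) / 2) :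
    2 * ∑ i ∈ s, Δ i ⌈/⌉ 2 + D ≤ n := by
  have hceil (i : ι) : ((Δ i ⌈/⌉ 2 : ℕ) : ℝ) ≤ (⌈(Δ i : ℝ) / 2⌉ : ℝ) := by
    have hle : (Δ i : ℝ) ≤ 2 * (⌈(Δ i : ℝ) / 2⌉ : ℝ) := by
      linarith [Int.le_ceil ((Δ i : ℝ) / 2)]
    have hle' : (Δ i : ℤ) ≤ 2 * ⌈(Δ i : ℝ) / 2⌉ := by exact_mod_cast hle
    have hceilDiv : ((Δ i ⌈/⌉ 2 : ℕ) : ℤ) ≤ ⌈(Δ i : ℝ) / 2⌉ := by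
      rw [Nat.ceilDiv_eq_add_pred_div]
      omega
    exact_mod_cast Int.cast_le (R := ℝ).2 hceilDiv
  have hsum : ((∑ i ∈ s, Δ i ⌈/⌉ 2 : ℕ) : ℝ) ≤ ∑ i ∈ s, (⌈(Δ i : ℝ) / 2⌉ : ℝ) := by
    rw [Nat.cast_sum]
    exact Finset.sum_le_sum fun i _ => hceil i
  have hlt : ((2 * ∑ i ∈ s, Δ i ⌈/⌉ 2 + D : ℕ) : ℝ) < (n + 1 : ℕ) := by
    push_cast at hsum ⊢
    linarith
  exact Nat.lt_succ_iff.1 (Nat.cast_lt.1 hlt)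

theorem card_mul_two_mul_sum_erase_add_le [Fintype ι] [DecidableEq ι] {o : ι}
    (h : ∀ i, Δ i ≤ Δ o) :
    2 * Fintype.card ι * (2 * ∑ i ∈ Finset.univ.erase o, Δ i ⌈/⌉ 2 + Δ o) ≤
      4 * Δ o * Fintype.card ι ^ 2 := by
  have hceil (i : ι) : Δ i ⌈/⌉ 2 ≤ Δ o :=
    (ceilDiv_le_iff_le_mul two_pos).2 ((h i).trans (Nat.le_mul_of_pos_left _ two_pos))
  have hcard : (Finset.univ.erase o).card + 1 = Fintype.card ι :=
    Finset.card_erase_add_one (Finset.mem_univ o)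
  calc 2 * Fintype.card ι * (2 * ∑ i ∈ Finset.univ.erase o, Δ i ⌈/⌉ 2 + Δ o)
      ≤ 2 * Fintype.card ι * (2 * ((Finset.univ.erase o).card * Δ o) + 2 * Δ o) := by
        gcongr
        · exact Finset.sum_le_card_nsmul _ _ _ fun i _ => hceil i
        · omega
    _ = 4 * Δ o * Fintype.card ι ^ 2 := by rw [← hcard]; ring

end Arithmetic

theorem theorem3 :
    ∃ c : ℕ, ∀ (h n : ℕ) (hh : 1 ≤ h) (V : Fin h → Type*) [∀ i, Fintype (V i)]
      (C : ∀ i, SimpleGraph (V i)) [∀ i, DecidableRel (C i).Adj] (Δ : Fin h → ℕ),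
      (∀ i, Fintype.card (V i) = n) →
      (∀ i, IsRegularCaterpillar (C i) (Δ i)) →
      Antitone Δ →
      Δ ⟨0, hh⟩ + h ≤ n →
      (∑ i, Δ i) + 1 ≤ n →
      (∑ i ∈ Finset.univ.erase (⟨0, hh⟩ : Fin h), (⌈(Δ i : ℝ) / 2⌉ : ℝ))
        < ((n : ℝ) - ((Δ ⟨0, hh⟩ : ℝ) - 1)) / 2 →
      ∃ k : ℕ, k ≤ c * Δ ⟨0, hh⟩ * h ^ 2 ∧
        ∃ G : SimpleGraph (Fin n), IsPacking C G ∧ IsKPlanar k G := by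
  refine ⟨4, fun h n hh V _ C _ Δ hcard hC hanti _ _ hsum => ⟨_, ?_,
    theorem3_general C Δ _ hcard hC (two_mul_sum_ceilDiv_add_le_of_sum_ceil_lt hsum)⟩⟩
  have hmax (i : Fin h) : Δ i ≤ Δ ⟨0, hh⟩ := hanti (Fin.le_def.2 i.val.zero_le)
  simpa using card_mul_two_mul_sum_erase_add_le hmax
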